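/- All functions are real valued. For a measurable $g:\mathbb R\to\mathbb R$ let $\|g\|_{BS}=\sup_{t\in\mathbb R}\int_t^{t+1}|g(x)|\,dx$, and let $BS(\mathbb R)$ be the space of all $g$ with $\|g\|_{BS}<\infty$. A function $g\in BS(\mathbb R)$ is Stepanov almost periodic if for every sequence $z_k\in\mathbb R$ the sequence of shifts $g(\cdot+z_k)$ has a subsequence that converges in $BS(\mathbb R)$. For a Carathéodory function $g(x,u)$ on $\mathbb R\times\mathbb R$ (continuous in $u$ for almost all $x$, Lebesgue measurable in $x$ for all $u$) and $R>0$ let $\|g\|_R=\big\|\sup_{|u|\le R}|g(\cdot,u)|\big\|_{BS}$; $g$ is strictly Stepanov almost periodic if $\|g\|_R<\infty$ for all $R>0$ and for every sequence $z_k\in\mathbb R$ there are a subsequence $z_{k'}$ and a Carathéodory function $g_h$ with $\|g_h\|_R<\infty$ and $\|g(\cdot+z_{k'},\cdot)-g_h\|_R\to0$ for all $R>0$. Let $\chi\in\{1,-1\}$, let $V:\mathbb R\to\mathbb R$ and $f:\mathbb R\times\mathbb R\to\mathbb R$, put $F(x,u)=\int_0^u f(x,s)\,ds$ and $f_u=\partial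 f/\partial u$, and assume the following. (i) $V$ is Stepanov almost periodic, and the spectrum of the self-adjoint operator $L=-\frac{d^2}{dx^2}+V$ in $L^2(\mathbb R)$, defined by the quadratic form $\int_{\mathbb R}(|u'|^2+V|u|^2)\,dx$ with form domain $H^1(\mathbb R)$, does not contain $0$. If $\chi=-1$, then the spectrum of $L$ also contains a point below $0$. (ii) For almost all $x$ the function $f(x,\cdot)$ is continuously differentiable. The functions $F$, $f$ and $f_u$ are strictly Stepanov almost periodic. For every $u\ne0$ there is $c>0$ with $F(x,u)\ge c$ for almost all $x$. (iii) $f(x,0)=f_u(x,0)=0$ for almost all $x$, and for every $R>0$ there is $\mu(R)>0$ such that for almost all $x$, $|f_u(x,u)-f_u(x,v)|\le\mu(R)|u-v|$ whenever $|u|,|v|\le R$. (iv) There is $\theta\in(0,1)$ such that for almost all $x$, $0<f(x,u)u\le\theta f_u(x,u)u^2$ for all $u\ne0$. Let $u\in H^1(\mathbb R)$ be a nontrivial weak solution of $-u''+V(x)u=\chi f(x,u)$, i.e. $u$ is not almost everywhere zero and $$\int_{\mathbb R}(u'\varphi'+Vu\varphi)\,dx=\chi\int_{\mathbb R}f(x,u(x))\varphi(x)\,dx\qquad\text{for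 all }\varphi\in C_0^\infty(\mathbb R).$$ Then (after modification on a null set) $u$ is continuously differentiable, its classical derivative coincides almost everywhere with its weak derivative, and there are constants $\alpha,\beta>0$ such that for all $x\in\mathbb R$ $$0<|u(x)|+|u'(x)|\le\alpha\exp(-\beta|x|).$$ -/

import Mathlib

open MeasureTheory Filter Topology
open scoped ENNReal

namespace GapSoliton

noncomputable section

/-- Test functions: infinitely differentiable, compactly supported functions on the line. -/
def IsTest (φ : ℝ → ℝ) : Prop :=
  ContDiff ℝ (⊤ : ℕ∞) φ ∧ HasCompactSupport φ

/-- `u ∈ H¹(ℝ)` and `du` is (a representative of) its weak derivative: both functions are square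
integrable and `∫ u φ' = - ∫ du φ` for all test functions `φ`. -/
structure HasH1Deriv (u du : ℝ → ℝ) : Prop where
  memLp : MemLp u 2 volume
  memLp_deriv : MemLp du 2 volume
  weak : ∀ φ : ℝ → ℝ, IsTest φ → ∫ x, u x * deriv φ x = -∫ x, du x * φ x

/-- The Stepanov norm `sup_t ∫_t^{t+1} |g(x)| dx`, with values in `[0, ∞]`. -/
def stepanovNorm (g : ℝ → ℝ) : ℝ≥0∞ :=
  ⨆ t : ℝ, ∫⁻ x in Set.Icc t (t + 1), ‖g x‖ₑ

/-- Stepanov bounded functions, the space `BS(ℝ)`.  (A measurable function with finite Stepanov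
norm is locally integrable.) -/
def StepanovBounded (g : ℝ → ℝ) : Prop :=
  AEMeasurable g volume ∧ stepanovNorm g < ∞

/-- Stepanov almost periodic functions, the space `S(ℝ)`: every sequence of shifts has a
subsequence that converges in `BS(ℝ)`. -/
def StepanovAP (g : ℝ → ℝ) : Prop :=
  StepanovBounded g ∧
    ∀ z : ℕ → ℝ, ∃ k : ℕ → ℕ, StrictMono k ∧ ∃ gh : ℝ → ℝ, StepanovBounded gh ∧
      Tendsto (fun n => stepanovNorm (fun x => g (x + z (k n)) - gh x)) atTop (𝓝 0)

/-- Carathéodory functions `g(x,u)`: continuous in `u` for almost all `x`, Lebesgue measurable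
in `x` for all `u`. -/
def IsCaratheodory (g : ℝ → ℝ → ℝ) : Prop :=
  (∀ᵐ x : ℝ, Continuous (g x)) ∧ ∀ u : ℝ, AEMeasurable (fun x => g x u) volume

/-- The seminorm `‖g‖_R`: the Stepanov norm of `x ↦ sup_{|u| ≤ R} |g(x,u)|`. -/
def stepanovNormOn (R : ℝ) (g : ℝ → ℝ → ℝ) : ℝ≥0∞ :=
  ⨆ t : ℝ, ∫⁻ x in Set.Icc t (t + 1), ⨆ u ∈ Set.Icc (-R) R, ‖g x u‖ₑ

/-- Functions `g(x,u)` that are strictly Stepanov almost periodic in `x`. -/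
def StrictlyStepanovAP (g : ℝ → ℝ → ℝ) : Prop :=
  IsCaratheodory g ∧ (∀ R : ℝ, 0 < R → stepanovNormOn R g < ∞) ∧
    ∀ z : ℕ → ℝ, ∃ k : ℕ → ℕ, StrictMono k ∧ ∃ gh : ℝ → ℝ → ℝ, IsCaratheodory gh ∧
      (∀ R : ℝ, 0 < R → stepanovNormOn R gh < ∞) ∧
      ∀ R : ℝ, 0 < R →
        Tendsto (fun n => stepanovNormOn R (fun x u => g (x + z (k n)) u - gh x u)) atTop (𝓝 0)

/-- The real Hilbert space `L²(ℝ)`. -/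
abbrev L2 : Type := Lp ℝ 2 (volume : Measure ℝ)

/-- The graph of the self-adjoint operator `L = -d²/dx² + V` in `L²(ℝ)` that is associated with
the quadratic form `∫ (|u'|² + V |u|²)` on the form domain `H¹(ℝ)`: `u` lies in the domain of `L`
and `L u = g` iff `u ∈ H¹(ℝ)` and `∫ (u' v' + V u v) = ∫ g v` for all `v ∈ H¹(ℝ)`. -/
def SchrodingerGraph (V : ℝ → ℝ) (u g : L2) : Prop :=
  ∃ du : ℝ → ℝ, HasH1Deriv u du ∧
    ∀ v dv : ℝ → ℝ, HasH1Deriv v dv →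
      ∫ x, (du x * dv x + V x * u x * v x) = ∫ x, g x * v x

/-- The (real) spectrum of `L = -d²/dx² + V`: those `s` for which `L - s` has no bounded two-sided
inverse `A : L²(ℝ) → dom L`.  (As `L` is self-adjoint, its spectrum is real; as it is a real
operator, invertibility of `L - s` for real `s` is the same on real and on complex `L²`.) -/
def schrodingerSpectrum (V : ℝ → ℝ) : Set ℝ :=
  {s : ℝ | ¬ ∃ A : L2 →L[ℝ] L2,
    (∀ g : L2, SchrodingerGraph V (A g) (g + s • A g)) ∧
    ∀ u g : L2, SchrodingerGraph V u g → A (g - s • u) = u}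

/-- The primitive `F(x,u) = ∫₀ᵘ f(x,s) ds` of the nonlinearity. -/
def primitive (f : ℝ → ℝ → ℝ) (x u : ℝ) : ℝ :=
  ∫ s in (0 : ℝ)..u, f x s

/-- The partial derivative `f_u(x,u)` of the nonlinearity. -/
def partialDeriv (f : ℝ → ℝ → ℝ) (x u : ℝ) : ℝ :=
  deriv (f x) u

/-- Standing assumptions on the potential `V` (for the sign `χ`). -/
structure PotentialAssumption (χ : ℝ) (V : ℝ → ℝ) : Prop where
  almostPeriodic : StepanovAP V
  zero_notMem : (0 : ℝ) ∉ schrodingerSpectrum V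
  neg_spectrum : χ = -1 → ∃ s ∈ schrodingerSpectrum V, s < 0

/-- Standing assumptions on the nonlinearity `f`. -/
structure NonlinearityAssumption (f : ℝ → ℝ → ℝ) : Prop where
  contDiff : ∀ᵐ x : ℝ, ContDiff ℝ 1 (f x)
  primitive_ap : StrictlyStepanovAP (primitive f)
  ap : StrictlyStepanovAP f
  partialDeriv_ap : StrictlyStepanovAP (partialDeriv f)
  primitive_lower : ∀ u : ℝ, u ≠ 0 → ∃ c : ℝ, 0 < c ∧ ∀ᵐ x : ℝ, c ≤ primitive f x u
  at_zero : ∀ᵐ x : ℝ, f x 0 = 0 ∧ partialDeriv f x 0 = 0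
  lipschitz : ∀ R : ℝ, 0 < R → ∃ μ : ℝ, 0 < μ ∧ ∀ᵐ x : ℝ, ∀ u v : ℝ, |u| ≤ R → |v| ≤ R →
    |partialDeriv f x u - partialDeriv f x v| ≤ μ * |u - v|
  superlinear : ∃ θ : ℝ, 0 < θ ∧ θ < 1 ∧ ∀ᵐ x : ℝ, ∀ u : ℝ, u ≠ 0 →
    0 < f x u * u ∧ f x u * u ≤ θ * (partialDeriv f x u * u ^ 2)

/-- `u` (with weak derivative `du`) is a weak solution in `H¹(ℝ)` of `-u'' + V u = χ f(x,u)`. -/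
def IsWeakSolution (χ : ℝ) (V : ℝ → ℝ) (f : ℝ → ℝ → ℝ) (u du : ℝ → ℝ) : Prop :=
  HasH1Deriv u du ∧ ∀ φ : ℝ → ℝ, IsTest φ →
    ∫ x, (du x * deriv φ x + V x * u x * φ x) = χ * ∫ x, f x (u x) * φ x

end

end GapSoliton

/-! ### Absolutely continuous functions, test functions and weak derivatives. -/

namespace GapSoliton

/-! In one dimension the equation makes `u` equal almost everywhere to a `C¹` function `w` with `w'`
locally absolutely continuous and `w'' = V w - χ f(x, w)`. An `H¹` function is bounded, and `f(x, 0)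
= f_u(x, 0) = 0` with `f_u` Lipschitz gives `|f(x, w)| ≤ μ w²`. Hence `|w''| ≤ Q |w|`, where the
integrals of `Q` over unit intervals are bounded.

Positivity is unique continuation: if `w` and `w'` vanish at one point, integrating this inequality
twice over a short interval gives `w = 0` there, and the common zero set is open and closed
(`SecondOrderBound.eq_zero_of_initial`).

Decay comes from the spectral gap at `0`, that is `‖y‖² ≤ K ‖L y‖²` in `L²`
(`exists_integral_sq_le`). Take `y = η w` with `η` vanishing on `[-T, T]` and equal to `1` off `[-T
- 1, T + 1]`. Then `L (η w) = η χ f(x, w) - 2 η' w' - η'' w`. For large `T` the first term is a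
small multiple of `η w` and is absorbed. The others live on the shell, where a local elliptic
estimate (`SecondOrderBound.exists_sq_add_sq_le`) bounds them by the mass of `w²` there. So the tail
mass satisfies `M (T + 1) ≤ C (M T - M (T + 1))` and decays geometrically; the same local estimate
turns this into pointwise decay of `w` and `w'` (`SecondOrderBound.exists_exp_bound`). -/

theorem locallyIntegrable_of_intervalIntegrable {f : ℝ → ℝ}
    (h : ∀ a b, IntervalIntegrable f volume a b) : LocallyIntegrable f volume := by
  rw [locallyIntegrable_iff]
  intro k hk
  obtain ⟨R, hR⟩ := hk.isBounded.subset_closedBall 0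
  have h1 : IntegrableOn f (Set.Icc (-|R|) |R|) volume :=
    (intervalIntegrable_iff_integrableOn_Icc_of_le (by linarith [abs_nonneg R])).1 (h _ _)
  refine h1.mono_set fun x hx => ?_
  have h2 := hR hx
  rw [Metric.mem_closedBall, Real.dist_eq, sub_zero] at h2
  exact abs_le.1 (h2.trans (le_abs_self R))

theorem _root_.MeasureTheory.LocallyIntegrable.intervalIntegrable_real {f : ℝ → ℝ}
    (h : LocallyIntegrable f volume) (a b : ℝ) : IntervalIntegrable f volume a b :=
  intervalIntegrable_iff.mpr <|
    (h.integrableOn_isCompact isCompact_uIcc).mono_set Set.uIoc_subset_uIcc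

/-- `w` is locally absolutely continuous with (locally integrable) derivative `d`. -/
structure IsPrimitive (w d : ℝ → ℝ) : Prop where
  intervalIntegrable : ∀ a b, IntervalIntegrable d volume a b
  sub_eq : ∀ a b, w b - w a = ∫ x in a..b, d x

namespace IsPrimitive

variable {v w d e : ℝ → ℝ}

theorem eq_add (h : IsPrimitive w d) (a : ℝ) : w = fun x => w a + ∫ t in a..x, d t := by
  ext x
  rw [← h.sub_eq a x]
  ring

theorem of_eq_add (hd : ∀ a b, IntervalIntegrable d volume a b) (c : ℝ) :
    IsPrimitive (fun x => c + ∫ t in (0 : ℝ)..x, d t) d :=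
  ⟨hd, fun a b => by
    rw [← intervalIntegral.integral_interval_sub_left (hd 0 b) (hd 0 a)]
    ring⟩

theorem continuous (h : IsPrimitive w d) : Continuous w := by
  rw [h.eq_add 0]
  exact continuous_const.add (intervalIntegral.continuous_primitive h.intervalIntegrable 0)

theorem ae_hasDerivAt (h : IsPrimitive w d) : ∀ᵐ x, HasDerivAt w (d x) x := by
  filter_upwards [_root_.LocallyIntegrable.ae_hasDerivAt_integral
    (locallyIntegrable_of_intervalIntegrable h.intervalIntegrable)] with x hx
  rw [h.eq_add 0]
  exact (hx 0).const_add _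

theorem hasDerivAt (h : IsPrimitive w d) (hd : Continuous d) (x : ℝ) : HasDerivAt w (d x) x := by
  rw [h.eq_add 0]
  exact (intervalIntegral.integral_hasDerivAt_right (h.intervalIntegrable 0 x)
    (hd.stronglyMeasurableAtFilter _ _) hd.continuousAt).const_add _

theorem absolutelyContinuousOnInterval (h : IsPrimitive w d) (a b : ℝ) :
    AbsolutelyContinuousOnInterval w a b := by
  rw [h.eq_add a]
  have h1 := (h.intervalIntegrable a b).absolutelyContinuousOnInterval_intervalIntegral
    (c := a) (by simp)
  have h2 : AbsolutelyContinuousOnInterval (fun _ : ℝ => w a) a b :=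
    (contDiff_const (n := 1)).contDiffOn.absolutelyContinuousOnInterval
  exact h2.add h1

theorem of_hasDerivAt (h : ∀ x, HasDerivAt w (d x) x) (hd : Continuous d) : IsPrimitive w d :=
  ⟨fun a b => hd.intervalIntegrable a b, fun a b =>
    (intervalIntegral.integral_eq_sub_of_hasDerivAt (fun x _ => h x)
      (hd.intervalIntegrable a b)).symm⟩

theorem congr_ae (h : IsPrimitive w d) (hde : d =ᵐ[volume] e) : IsPrimitive w e :=
  ⟨fun a b => (h.intervalIntegrable a b).congr_ae (ae_restrict_of_ae hde), fun a b => by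
    rw [h.sub_eq]
    exact intervalIntegral.integral_congr_ae (hde.mono fun x hx _ => hx)⟩

theorem add (hw : IsPrimitive w d) (hv : IsPrimitive v e) :
    IsPrimitive (fun x => w x + v x) (fun x => d x + e x) :=
  ⟨fun a b => (hw.intervalIntegrable a b).add (hv.intervalIntegrable a b), fun a b => by
    rw [intervalIntegral.integral_add (hw.intervalIntegrable a b) (hv.intervalIntegrable a b),
      ← hw.sub_eq, ← hv.sub_eq]
    ring⟩

/-- Integration by parts for absolutely continuous functions. Classical calculus would not do: `w'`
is differentiable only almost everywhere. -/
theorem mul (hw : IsPrimitive w d) (hv : IsPrimitive v e) :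
    IsPrimitive (fun x => w x * v x) (fun x => d x * v x + w x * e x) := by
  refine ⟨fun a b => ((hw.intervalIntegrable a b).mul_continuousOn hv.continuous.continuousOn).add
    ((hv.intervalIntegrable a b).continuousOn_mul hw.continuous.continuousOn), fun a b => ?_⟩
  rw [← (hw.absolutelyContinuousOnInterval a b).integral_deriv_mul_eq_sub
    (hv.absolutelyContinuousOnInterval a b)]
  apply intervalIntegral.integral_congr_ae
  filter_upwards [hw.ae_hasDerivAt, hv.ae_hasDerivAt] with x h1 h2 _
  rw [h1.deriv, h2.deriv]

theorem integral_eq_zero (h : IsPrimitive w d) (hd : Integrable d)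
    (htop : Tendsto w atTop (𝓝 0)) (hbot : Tendsto w atBot (𝓝 0)) : ∫ x, d x = 0 := by
  have h1 := intervalIntegral_tendsto_integral hd tendsto_neg_atTop_atBot
    (tendsto_id (α := ℝ) (x := atTop))
  have h2 : Tendsto (fun i : ℝ => ∫ x in -i..id i, d x) atTop (𝓝 (0 - 0)) := by
    simp_rw [← h.sub_eq]
    exact htop.sub (hbot.comp tendsto_neg_atTop_atBot)
  rw [sub_zero] at h2
  exact tendsto_nhds_unique h1 h2

theorem integral_eq_zero_of_hasCompactSupport (h : IsPrimitive w d) (hd : Integrable d)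
    (hw : HasCompactSupport w) : ∫ x, d x = 0 := by
  have h1 := hw.is_zero_at_infty
  rw [cocompact_eq_atBot_atTop, tendsto_sup] at h1
  exact h.integral_eq_zero hd h1.2 h1.1

end IsPrimitive

theorem IsTest.continuous {φ : ℝ → ℝ} (h : IsTest φ) : Continuous φ := h.1.continuous

theorem IsTest.hasDerivAt {φ : ℝ → ℝ} (h : IsTest φ) (x : ℝ) : HasDerivAt φ (deriv φ x) x :=
  (h.1.differentiable (by simp) x).hasDerivAt

theorem IsTest.deriv {φ : ℝ → ℝ} (h : IsTest φ) : IsTest (deriv φ) := by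
  refine ⟨?_, h.2.deriv⟩
  have h1 : ContDiff ℝ ((⊤ : ℕ∞) + 1) φ := h.1
  exact (contDiff_succ_iff_deriv.1 h1).2.2

theorem IsTest.isPrimitive {φ : ℝ → ℝ} (h : IsTest φ) : IsPrimitive φ (_root_.deriv φ) :=
  .of_hasDerivAt h.hasDerivAt h.deriv.continuous

theorem IsTest.integrable_mul {φ : ℝ → ℝ} (h : IsTest φ) {g : ℝ → ℝ}
    (hg : LocallyIntegrable g volume) : Integrable (fun x => g x * φ x) := by
  have := hg.integrable_smul_left_of_hasCompactSupport h.continuous h.2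
  simpa [mul_comm] using this

/-- The integral of `φ` from `-∞` vanishes to the left of the support trivially, and to the right
because the total integral is zero. -/
theorem IsTest.exists_primitive {φ : ℝ → ℝ} (h : IsTest φ) (h0 : ∫ x, φ x = 0) :
    ∃ Φ, IsTest Φ ∧ _root_.deriv Φ = φ := by
  obtain ⟨R, hR⟩ := h.2.isCompact.isBounded.subset_closedBall 0
  have hz : ∀ x, R < |x| → φ x = 0 := fun x hx => by
    by_contra hne
    have := hR (subset_tsupport _ hne)
    rw [Metric.mem_closedBall, Real.dist_eq, sub_zero] at this
    linarith
  have hint : Integrable φ := h.continuous.integrable_of_hasCompactSupport h.2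
  have hd : ∀ x, HasDerivAt (fun x => ∫ t in Set.Iic x, φ t) (φ x) x := by
    have hP := IsPrimitive.of_eq_add (d := φ) (fun a b => hint.intervalIntegrable)
      (∫ t in Set.Iic (0 : ℝ), φ t)
    have heq : (fun x => ∫ t in Set.Iic x, φ t) =
        fun x => (∫ t in Set.Iic (0 : ℝ), φ t) + ∫ t in (0 : ℝ)..x, φ t := by
      ext x
      rw [← intervalIntegral.integral_Iic_sub_Iic hint.integrableOn hint.integrableOn]
      ring
    rw [heq]
    exact hP.hasDerivAt h.continuous
  have hde : _root_.deriv (fun x => ∫ t in Set.Iic x, φ t) = φ := funext fun x => (hd x).deriv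
  refine ⟨fun x => ∫ t in Set.Iic x, φ t, ⟨?_, ?_⟩, hde⟩
  · have : ContDiff ℝ ((⊤ : ℕ∞) + 1) (fun x => ∫ t in Set.Iic x, φ t) := by
      rw [contDiff_succ_iff_deriv]
      refine ⟨fun x => (hd x).differentiableAt, by simp, ?_⟩
      rw [hde]
      exact h.1
    exact this
  · refine HasCompactSupport.of_support_subset_isCompact (isCompact_closedBall (0 : ℝ) R) ?_
    intro x hx
    rw [Metric.mem_closedBall, Real.dist_eq, sub_zero]
    by_contra! hlt
    apply hx
    rcases lt_abs.1 hlt with hx' | hx'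
    · rw [← h0, ← intervalIntegral.integral_Iic_add_Ioi (b := x) hint.integrableOn
        hint.integrableOn, setIntegral_eq_zero_of_forall_eq_zero (t := Set.Ioi x), add_zero]
      intro y hy
      exact hz y (lt_abs.2 (.inl (hx'.trans hy)))
    · refine setIntegral_eq_zero_of_forall_eq_zero fun y hy => hz y (lt_abs.2 (.inr ?_))
      have : y ≤ x := hy
      linarith

theorem exists_isTest_integral_eq_one : ∃ ψ, IsTest ψ ∧ ∫ x, ψ x = 1 := by
  let b : ContDiffBump (0 : ℝ) := ⟨1, 2, by norm_num, by norm_num⟩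
  exact ⟨b.normed volume, ⟨b.contDiff_normed, b.hasCompactSupport_normed⟩, b.integral_normed⟩

/-- A distribution with vanishing derivative is constant (du Bois-Reymond). -/
theorem exists_ae_eq_const {g : ℝ → ℝ} (hg : LocallyIntegrable g volume)
    (h : ∀ φ, IsTest φ → ∫ x, g x * deriv φ x = 0) : ∃ c : ℝ, ∀ᵐ x, g x = c := by
  obtain ⟨ψ, hψ, hψ1⟩ := exists_isTest_integral_eq_one
  refine ⟨∫ x, g x * ψ x, ae_eq_of_integral_contDiff_smul_eq hg
    (locallyIntegrable_const _) fun φ hφ1 hφ2 => ?_⟩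
  have hφ : IsTest φ := ⟨hφ1, hφ2⟩
  have hφi : Integrable φ := hφ.continuous.integrable_of_hasCompactSupport hφ.2
  have hψi : Integrable ψ := hψ.continuous.integrable_of_hasCompactSupport hψ.2
  -- Removing the mean of `φ` with the fixed `ψ` leaves the derivative of a test function, on which
  -- `g` vanishes by hypothesis.
  have hχ : IsTest (fun x => φ x - (∫ y, φ y) * ψ x) :=
    ⟨hφ.1.sub (contDiff_const.mul hψ.1), hφ.2.sub hψ.2.mul_left⟩
  obtain ⟨Φ, hΦ, hΦd⟩ := hχ.exists_primitive (by
    rw [integral_sub hφi (hψi.const_mul _), integral_const_mul, hψ1, mul_one, sub_self])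
  have h1 := h Φ hΦ
  rw [hΦd] at h1
  have h2 : (fun x => g x * (φ x - (∫ y, φ y) * ψ x)) =
      fun x => g x * φ x - (∫ y, φ y) * (g x * ψ x) := by
    ext x; ring
  rw [h2, integral_sub (hφ.integrable_mul hg) ((hψ.integrable_mul hg).const_mul _),
    integral_const_mul] at h1
  simp_rw [smul_eq_mul]
  rw [integral_mul_const, show (fun a => φ a * g a) = fun a => g a * φ a from
    funext fun a => mul_comm _ _]
  linarith

theorem IsPrimitive.integral_mul_deriv_isTest {w d φ : ℝ → ℝ} (h : IsPrimitive w d)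
    (hφ : IsTest φ) : ∫ x, w x * deriv φ x = -∫ x, d x * φ x := by
  have h1 := hφ.integrable_mul (locallyIntegrable_of_intervalIntegrable h.intervalIntegrable)
  have h2 := hφ.deriv.integrable_mul h.continuous.locallyIntegrable
  have h3 := (h.mul hφ.isPrimitive).integral_eq_zero_of_hasCompactSupport (h1.add h2)
    hφ.2.mul_left
  rw [integral_add h1 h2] at h3
  linarith

/-- A locally integrable function with locally integrable weak derivative has a locally absolutely
continuous representative. -/
theorem exists_isPrimitive_of_weak {g d : ℝ → ℝ} (hg : LocallyIntegrable g volume)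
    (hd : LocallyIntegrable d volume)
    (h : ∀ φ, IsTest φ → ∫ x, g x * deriv φ x = -∫ x, d x * φ x) :
    ∃ w, IsPrimitive w d ∧ w =ᵐ[volume] g := by
  have hP := IsPrimitive.of_eq_add hd.intervalIntegrable_real 0
  have hPl := hP.continuous.locallyIntegrable (μ := volume)
  obtain ⟨c, hc⟩ := exists_ae_eq_const (hg.sub hPl) fun φ hφ => by
    simp_rw [Pi.sub_apply, sub_mul]
    rw [integral_sub (hφ.deriv.integrable_mul hg) (hφ.deriv.integrable_mul hPl), h φ hφ,
      hP.integral_mul_deriv_isTest hφ, sub_self]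
  refine ⟨_, IsPrimitive.of_eq_add hd.intervalIntegrable_real c, ?_⟩
  filter_upwards [hc] with x hx
  rw [Pi.sub_apply] at hx
  linarith

end GapSoliton

/-! ### Stepanov bounded potentials acting on `H¹`. -/

namespace GapSoliton

theorem StepanovBounded.locallyIntegrable {V : ℝ → ℝ} (hV : StepanovBounded V) :
    LocallyIntegrable V volume := by
  intro x
  refine ⟨Set.Icc (x - 1 / 2) (x - 1 / 2 + 1), Icc_mem_nhds (by linarith) (by linarith),
    hV.1.aestronglyMeasurable.restrict, ?_⟩
  exact (le_iSup (fun t : ℝ => ∫⁻ x in Set.Icc t (t + 1), ‖V x‖ₑ) (x - 1 / 2)).trans_lt hV.2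

theorem StepanovBounded.exists_integral_le {V : ℝ → ℝ} (hV : StepanovBounded V) :
    ∃ B : ℝ, 0 < B ∧ ∀ t, ∫ x in t..t + 1, |V x| ≤ B := by
  refine ⟨(stepanovNorm V).toReal + 1, by positivity, fun t => ?_⟩
  rw [intervalIntegral.integral_of_le (by linarith), ← integral_Icc_eq_integral_Ioc]
  simp_rw [← Real.norm_eq_abs]
  rw [integral_norm_eq_lintegral_enorm hV.1.aestronglyMeasurable.restrict]
  have := ENNReal.toReal_mono hV.2.ne
    (le_iSup (fun t : ℝ => ∫⁻ x in Set.Icc t (t + 1), ‖V x‖ₑ) t)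
  change _ ≤ (stepanovNorm V).toReal at this
  linarith

theorem HasH1Deriv.exists_isPrimitive {u du : ℝ → ℝ} (h : HasH1Deriv u du) :
    ∃ w, IsPrimitive w du ∧ w =ᵐ[volume] u :=
  exists_isPrimitive_of_weak (h.memLp.locallyIntegrable (by norm_num))
    (h.memLp_deriv.locallyIntegrable (by norm_num)) h.weak

theorem intervalIntegral_le_of_subset {h : ℝ → ℝ} {a b c d : ℝ} (hab : a ≤ b) (hca : c ≤ a)
    (hbd : b ≤ d) (hh : ∀ x, 0 ≤ h x) (hi : IntervalIntegrable h volume c d) :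
    ∫ x in a..b, h x ≤ ∫ x in c..d, h x :=
  intervalIntegral.integral_mono_interval hca hab hbd (Eventually.of_forall hh) hi

namespace IsPrimitive

variable {v d : ℝ → ℝ}

/-- Average `v x ^ 2 = v y ^ 2 - ∫ 2 v v'` over `y` in `[x, x + 1]`. The bound is local on purpose:
it yields boundedness, decay at infinity and integrability of `V v²`. -/
theorem sq_le (h : IsPrimitive v d) (hv : MemLp v 2) (hd : MemLp d 2) (x : ℝ) :
    v x ^ 2 ≤ ∫ y in x..x + 1, (2 * v y ^ 2 + d y ^ 2) := by
  have hvi := hv.integrable_sq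
  have hdi := hd.integrable_sq
  have hi : Integrable (fun y => v y ^ 2 + d y ^ 2) := hvi.add hdi
  have key : ∀ y ∈ Set.Icc x (x + 1),
      v x ^ 2 - (∫ y in x..x + 1, (v y ^ 2 + d y ^ 2)) ≤ v y ^ 2 := by
    intro y hy
    have h1 := (h.mul h).sub_eq x y
    have h2 : -∫ t in x..y, (v t ^ 2 + d t ^ 2) ≤ ∫ t in x..y, (d t * v t + v t * d t) := by
      rw [← intervalIntegral.integral_neg]
      refine intervalIntegral.integral_mono_on hy.1 hi.neg.intervalIntegrable
        ((h.mul h).intervalIntegrable _ _) fun t _ => ?_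
      nlinarith [sq_nonneg (v t + d t)]
    have h3 := intervalIntegral_le_of_subset (h := fun y => v y ^ 2 + d y ^ 2) hy.1 le_rfl hy.2
      (fun t => by positivity) hi.intervalIntegrable
    nlinarith
  have h4 := intervalIntegral.integral_mono_on (by linarith) intervalIntegrable_const
    hvi.intervalIntegrable key
  rw [intervalIntegral.integral_const, add_sub_cancel_left, one_smul] at h4
  have h5 : ∫ y in x..x + 1, (2 * v y ^ 2 + d y ^ 2) =
      (∫ y in x..x + 1, v y ^ 2) + ∫ y in x..x + 1, (v y ^ 2 + d y ^ 2) := by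
    rw [← intervalIntegral.integral_add hvi.intervalIntegrable hi.intervalIntegrable]
    congr 1
    ext y
    ring
  linarith

theorem integrable_energy (hv : MemLp v 2) (hd : MemLp d 2) :
    Integrable (fun y => 2 * v y ^ 2 + d y ^ 2) :=
  (hv.integrable_sq.const_mul 2).add hd.integrable_sq

theorem exists_abs_le (h : IsPrimitive v d) (hv : MemLp v 2) (hd : MemLp d 2) :
    ∃ R : ℝ, 0 < R ∧ ∀ x, |v x| ≤ R := by
  have hi := integrable_energy hv hd
  set E := ∫ y, (2 * v y ^ 2 + d y ^ 2) with hE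
  have h1 : ∀ x, v x ^ 2 ≤ E := fun x => by
    refine (h.sq_le hv hd x).trans ?_
    rw [intervalIntegral.integral_of_le (by linarith)]
    exact setIntegral_le_integral hi (Eventually.of_forall fun y => by positivity)
  refine ⟨E + 1, by nlinarith [h1 0, sq_nonneg (v 0)], fun x => ?_⟩
  refine abs_le_of_sq_le_sq ?_ (by nlinarith [h1 0, sq_nonneg (v 0)])
  nlinarith [h1 x, sq_nonneg (v x)]

theorem tendsto_zero (h : IsPrimitive v d) (hv : MemLp v 2) (hd : MemLp d 2) :
    Tendsto v atTop (𝓝 0) ∧ Tendsto v atBot (𝓝 0) := by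
  have hi := integrable_energy hv hd
  have hs : ∀ x : ℝ, ∫ y in x..x + 1, (2 * v y ^ 2 + d y ^ 2) =
      (∫ y in (0 : ℝ)..x + 1, (2 * v y ^ 2 + d y ^ 2)) - ∫ y in (0 : ℝ)..x, (2 * v y ^ 2 + d y ^ 2) :=
    fun x => (intervalIntegral.integral_interval_sub_left hi.intervalIntegrable
      hi.intervalIntegrable).symm
  have hs' : ∀ x : ℝ, ∫ y in x..x + 1, (2 * v y ^ 2 + d y ^ 2) =
      (∫ y in x..(0 : ℝ), (2 * v y ^ 2 + d y ^ 2)) -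
        ∫ y in x + 1..(0 : ℝ), (2 * v y ^ 2 + d y ^ 2) := fun x => by
    rw [hs, intervalIntegral.integral_symm 0 x, intervalIntegral.integral_symm 0 (x + 1)]
    ring
  have fin : ∀ l : Filter ℝ, Tendsto (fun x => ∫ y in x..x + 1, (2 * v y ^ 2 + d y ^ 2)) l (𝓝 0) →
      Tendsto v l (𝓝 0) := fun l hl => by
    have h1 : Tendsto (fun x => v x ^ 2) l (𝓝 0) :=
      squeeze_zero (fun x => sq_nonneg _) (fun x => h.sq_le hv hd x) hl
    have h2 := (Real.continuous_sqrt.tendsto 0).comp h1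
    rw [Real.sqrt_zero] at h2
    refine (tendsto_zero_iff_abs_tendsto_zero _).2 (h2.congr fun x => ?_)
    simp [Real.sqrt_sq_eq_abs]
  constructor <;> apply fin
  · have h1 := intervalIntegral_tendsto_integral_Ioi 0 hi.integrableOn (tendsto_id (α := ℝ))
    have h2 := intervalIntegral_tendsto_integral_Ioi 0 hi.integrableOn
      (tendsto_atTop_add_const_right atTop (1 : ℝ) tendsto_id)
    have h3 := h2.sub h1
    rw [sub_self] at h3
    exact h3.congr fun x => (hs x).symm
  · have h1 := intervalIntegral_tendsto_integral_Iic 0 hi.integrableOn (tendsto_id (α := ℝ))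
    have h2 := intervalIntegral_tendsto_integral_Iic 0 hi.integrableOn
      (tendsto_atBot_add_const_right atBot (1 : ℝ) tendsto_id)
    have h3 := h1.sub h2
    rw [sub_self] at h3
    exact h3.congr fun x => (hs' x).symm

end IsPrimitive

/-- Tonelli: after the swap, `|h y|` is weighted by the integral of `|V|` over `[y - 1, y]`.
Together with `IsPrimitive.sq_le` this makes the form of `L` finite on `H¹`. -/
theorem StepanovBounded.lintegral_mul_le {V h : ℝ → ℝ} (hV : StepanovBounded V)
    (hh : Integrable h) :
    ∫⁻ x, ‖V x‖ₑ * ∫⁻ y in Set.Icc x (x + 1), ‖h y‖ₑ ≤ stepanovNorm V * ∫⁻ y, ‖h y‖ₑ := by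
  let S : Set (ℝ × ℝ) := {p | p.1 ≤ p.2 ∧ p.2 ≤ p.1 + 1}
  have hS : MeasurableSet S :=
    (measurableSet_le measurable_fst measurable_snd).inter
      (measurableSet_le measurable_snd (measurable_fst.add_const 1))
  have hm : AEMeasurable (Function.uncurry fun x y : ℝ =>
      S.indicator (fun p : ℝ × ℝ => ‖V p.1‖ₑ * ‖h p.2‖ₑ) (x, y)) (volume.prod volume) := by
    refine AEMeasurable.indicator ?_ hS
    exact (hV.1.comp_fst.enorm).mul (hh.aemeasurable.comp_snd.enorm)
  calc ∫⁻ x, ‖V x‖ₑ * ∫⁻ y in Set.Icc x (x + 1), ‖h y‖ₑ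
      = ∫⁻ x, ∫⁻ y, S.indicator (fun p : ℝ × ℝ => ‖V p.1‖ₑ * ‖h p.2‖ₑ) (x, y) := by
        refine lintegral_congr fun x => ?_
        rw [← lintegral_const_mul'' _ hh.aemeasurable.enorm.restrict,
          ← lintegral_indicator measurableSet_Icc]
        rfl
    _ = ∫⁻ y, ∫⁻ x, S.indicator (fun p : ℝ × ℝ => ‖V p.1‖ₑ * ‖h p.2‖ₑ) (x, y) :=
        lintegral_lintegral_swap hm
    _ = ∫⁻ y, (∫⁻ x in Set.Icc (y - 1) (y - 1 + 1), ‖V x‖ₑ) * ‖h y‖ₑ := by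
        refine lintegral_congr fun y => ?_
        rw [← lintegral_mul_const'' _ hV.1.enorm.restrict,
          ← lintegral_indicator measurableSet_Icc]
        refine lintegral_congr fun x => ?_
        have : (x, y) ∈ S ↔ x ∈ Set.Icc (y - 1) (y - 1 + 1) := by
          simp only [S, Set.mem_ofPred_eq, Set.mem_Icc]
          constructor <;> rintro ⟨h1, h2⟩ <;> constructor <;> linarith
        by_cases hx : x ∈ Set.Icc (y - 1) (y - 1 + 1)
        · rw [Set.indicator_of_mem (this.2 hx), Set.indicator_of_mem hx]
        · rw [Set.indicator_of_notMem (mt this.1 hx), Set.indicator_of_notMem hx]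
    _ ≤ ∫⁻ y, stepanovNorm V * ‖h y‖ₑ := by
        refine lintegral_mono fun y => ?_
        gcongr
        exact le_iSup (fun t : ℝ => ∫⁻ x in Set.Icc t (t + 1), ‖V x‖ₑ) (y - 1)
    _ = stepanovNorm V * ∫⁻ y, ‖h y‖ₑ := lintegral_const_mul'' _ hh.aemeasurable.enorm

theorem StepanovBounded.integrable_mul_sq {V v d : ℝ → ℝ} (hV : StepanovBounded V)
    (h : IsPrimitive v d) (hv : MemLp v 2) (hd : MemLp d 2) :
    Integrable (fun x => V x * v x ^ 2) := by
  have hi := IsPrimitive.integrable_energy hv hd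
  refine ⟨hV.1.aestronglyMeasurable.mul (h.continuous.pow 2).aestronglyMeasurable, ?_⟩
  refine lt_of_le_of_lt (lintegral_mono fun x => ?_) ((hV.lintegral_mul_le hi).trans_lt
    (ENNReal.mul_lt_top hV.2 hi.hasFiniteIntegral))
  rw [enorm_mul]
  gcongr
  have h1 := h.sq_le hv hd x
  rw [intervalIntegral.integral_of_le (by linarith), ← integral_Icc_eq_integral_Ioc] at h1
  rw [Real.enorm_eq_ofReal (sq_nonneg _)]
  refine (ENNReal.ofReal_le_ofReal h1).trans ?_
  rw [← Real.enorm_eq_ofReal (integral_nonneg fun y => by positivity)]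
  exact enorm_integral_le_lintegral_enorm _

theorem StepanovBounded.integrable_mul_mul {V v d w e : ℝ → ℝ} (hV : StepanovBounded V)
    (h : IsPrimitive v d) (hv : MemLp v 2) (hd : MemLp d 2)
    (h' : IsPrimitive w e) (hw : MemLp w 2) (he : MemLp e 2) :
    Integrable (fun x => V x * v x * w x) := by
  refine ((hV.integrable_mul_sq h hv hd).norm.add (hV.integrable_mul_sq h' hw he).norm).mono'
    ((hV.1.aestronglyMeasurable.mul h.continuous.aestronglyMeasurable).mul
      h'.continuous.aestronglyMeasurable) (Eventually.of_forall fun x => ?_)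
  simp only [Pi.add_apply, Real.norm_eq_abs, abs_mul, abs_pow, ← mul_add, mul_assoc]
  gcongr
  nlinarith [sq_nonneg (|v x| - |w x|), sq_nonneg |v x|, sq_nonneg |w x|]

end GapSoliton

/-! ### Local estimates and unique continuation for `|w''| ≤ Q |w|`. -/

namespace GapSoliton

/-- `w` is `C¹` with derivative `d`, `d` is locally absolutely continuous with derivative `q`, and
`|w''| ≤ Q |w|` with a potential `Q ≥ 0` whose integrals over unit intervals are at most `B`. -/
structure SecondOrderBound (w d q Q : ℝ → ℝ) (B : ℝ) : Prop where
  isPrimitive : IsPrimitive w d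
  isPrimitive_deriv : IsPrimitive d q
  intervalIntegrable : ∀ a b, IntervalIntegrable Q volume a b
  nonneg : ∀ x, 0 ≤ Q x
  pos : 0 < B
  integral_le : ∀ t, ∫ x in t..t + 1, Q x ≤ B
  le : ∀ᵐ x, |q x| ≤ Q x * |w x|

namespace SecondOrderBound

variable {w d q Q : ℝ → ℝ} {B : ℝ}

theorem hasDerivAt (h : SecondOrderBound w d q Q B) (x : ℝ) : HasDerivAt w (d x) x :=
  h.isPrimitive.hasDerivAt h.isPrimitive_deriv.continuous x

theorem abs_sub_le (h : SecondOrderBound w d q Q B) {a b m : ℝ} (hab : b ≤ a + 1)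
    (hm : ∀ x ∈ Set.Icc a b, |w x| ≤ m) {x y : ℝ} (hx : x ∈ Set.Icc a b)
    (hy : y ∈ Set.Icc a b) : |d x - d y| ≤ B * m := by
  wlog hyx : y ≤ x generalizing x y
  · rw [abs_sub_comm]
    exact this hy hx (not_le.1 hyx).le
  have hm0 : 0 ≤ m := (abs_nonneg _).trans (hm x hx)
  rw [h.isPrimitive_deriv.sub_eq, ← Real.norm_eq_abs]
  have h1 : ‖∫ t in y..x, q t‖ ≤ ∫ t in y..x, Q t * m := by
    refine intervalIntegral.norm_integral_le_of_norm_le hyx ?_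
      ((h.intervalIntegrable _ _).mul_const m)
    filter_upwards [h.le] with t ht htm
    refine ht.trans (mul_le_mul_of_nonneg_left (hm t ?_) (h.nonneg t))
    exact ⟨hy.1.trans htm.1.le, htm.2.trans hx.2⟩
  refine h1.trans ?_
  rw [intervalIntegral.integral_mul_const]
  refine mul_le_mul_of_nonneg_right ?_ hm0
  exact (intervalIntegral_le_of_subset hyx hy.1 (hx.2.trans hab) h.nonneg
    (h.intervalIntegrable _ _)).trans (h.integral_le a)

theorem abs_sub_le_mul (h : SecondOrderBound w d q Q B) {a b m : ℝ}
    (hm : ∀ x ∈ Set.Icc a b, |d x| ≤ m) {x y : ℝ} (hx : x ∈ Set.Icc a b)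
    (hy : y ∈ Set.Icc a b) : |w x - w y| ≤ m * |x - y| := by
  have := (convex_Icc a b).norm_image_sub_le_of_norm_hasDerivWithin_le
    (fun z _ => (h.hasDerivAt z).hasDerivWithinAt) hm hy hx
  simpa using this

theorem exists_max (h : SecondOrderBound w d q Q B) {a b : ℝ} (hab : a ≤ b) :
    ∃ x₀ ∈ Set.Icc a b, ∀ x ∈ Set.Icc a b, |w x| ≤ |w x₀| := by
  obtain ⟨x₀, h1, h2⟩ := isCompact_Icc.exists_isMaxOn (Set.nonempty_Icc.2 hab)
    (h.isPrimitive.continuous.abs.continuousOn)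
  exact ⟨x₀, h1, fun x hx => h2 hx⟩

/-- Local elliptic estimate: on a unit interval, the `C¹` norm is controlled by the `L²` norm. -/
theorem exists_sq_add_sq_le (h : SecondOrderBound w d q Q B) : ∃ C : ℝ, 0 < C ∧
    ∀ T, ∀ x ∈ Set.Icc T (T + 1), w x ^ 2 + d x ^ 2 ≤ C * ∫ y in T..T + 1, w y ^ 2 := by
  have hB := h.pos
  -- With slope at most `(B + 2) m`, where `m` is the maximum of `|w|`, the function stays above `m
  -- / 2` within distance `δ` of a maximum point.
  set δ : ℝ := 1 / (2 * (B + 2)) with hδ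
  have hδ0 : 0 < δ := by positivity
  have hδB : (B + 2) * δ = 1 / 2 := by rw [hδ]; field_simp
  have hδ1 : δ ≤ 1 / 2 := by nlinarith
  refine ⟨(1 + (B + 2) ^ 2) * (4 / δ), by positivity, fun T => ?_⟩
  obtain ⟨x₀, hx₀, hmax⟩ := h.exists_max (show T ≤ T + 1 by linarith)
  set m := |w x₀| with hm
  have hm0 : 0 ≤ m := abs_nonneg _
  -- The mean value theorem gives a point where `|d| ≤ 2 m`, and `d` oscillates by at most `B m` on
  -- a unit interval.
  have hdm : ∀ x ∈ Set.Icc T (T + 1), |d x| ≤ (B + 2) * m := by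
    intro x hx
    obtain ⟨y, hy, hyd⟩ := exists_hasDerivAt_eq_slope w d (show T < T + 1 by linarith)
      h.isPrimitive.continuous.continuousOn fun z _ => h.hasDerivAt z
    have h1 := h.abs_sub_le le_rfl hmax hx (Set.Ioo_subset_Icc_self hy)
    have h2 := hmax T ⟨le_rfl, by linarith⟩
    have h3 := hmax (T + 1) ⟨by linarith, le_rfl⟩
    rw [add_sub_cancel_left, div_one] at hyd
    rw [abs_le] at *
    constructor <;> linarith [h1.1, h1.2, h2.1, h2.2, h3.1, h3.2]
  have hint : δ * (m / 2) ^ 2 ≤ ∫ y in T..T + 1, w y ^ 2 := by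
    -- The interval of length `δ` goes to the right or left of `x₀`, whichever stays inside `[T, T +
    -- 1]`.
    obtain ⟨a, ha, ha', hax⟩ : ∃ a, T ≤ a ∧ a + δ ≤ T + 1 ∧
        ∀ x ∈ Set.Icc a (a + δ), |x - x₀| ≤ δ := by
      rcases le_total x₀ (T + 1 - δ) with hc | hc
      · refine ⟨x₀, hx₀.1, by linarith, fun x hx => ?_⟩
        rw [abs_le]
        constructor <;> linarith [hx.1, hx.2]
      · refine ⟨x₀ - δ, by linarith, by linarith [hx₀.2], fun x hx => ?_⟩
        rw [abs_le]
        constructor <;> linarith [hx.1, hx.2]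
    have hwi : ∀ a b, IntervalIntegrable (fun y => w y ^ 2) volume a b :=
      fun a b => (h.isPrimitive.continuous.pow 2).intervalIntegrable a b
    have h1 : ∫ _ in a..a + δ, (m / 2) ^ 2 ≤ ∫ y in a..a + δ, w y ^ 2 := by
      refine intervalIntegral.integral_mono_on (by linarith) intervalIntegrable_const (hwi _ _)
        fun x hx => ?_
      have hxT : x ∈ Set.Icc T (T + 1) := ⟨ha.trans hx.1, hx.2.trans ha'⟩
      have h2 := h.abs_sub_le_mul hdm hxT hx₀
      have h3 : |w x - w x₀| ≤ m / 2 := by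
        refine h2.trans ?_
        have := mul_le_mul_of_nonneg_left (hax x hx) (by positivity : 0 ≤ (B + 2) * m)
        nlinarith
      have h4 : m / 2 ≤ |w x| := by
        have := abs_sub_abs_le_abs_sub (w x₀) (w x)
        rw [abs_sub_comm] at this
        linarith
      rw [← sq_abs (w x)]
      gcongr
    rw [intervalIntegral.integral_const, add_sub_cancel_left, smul_eq_mul] at h1
    exact h1.trans (intervalIntegral_le_of_subset (by linarith) ha ha'
      (fun _ => sq_nonneg _) (hwi _ _))
  intro x hx
  have h1 : w x ^ 2 ≤ m ^ 2 := by
    rw [← sq_abs (w x)]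
    gcongr
    exact hmax x hx
  have h2 : d x ^ 2 ≤ ((B + 2) * m) ^ 2 := by
    rw [← sq_abs (d x)]
    gcongr
    exact hdm x hx
  calc w x ^ 2 + d x ^ 2 ≤ (1 + (B + 2) ^ 2) * m ^ 2 := by linarith
    _ = (1 + (B + 2) ^ 2) * (4 / δ) * (δ * (m / 2) ^ 2) := by field_simp; ring
    _ ≤ _ := by gcongr

/-- Around a common zero of `w` and `d`, the maximum `m` of `|w|` on radius `δ` satisfies `m ≤ B m δ
≤ m / 2`, so `m = 0`. The common zero set is therefore open as well as closed. -/
theorem eq_zero_of_initial (h : SecondOrderBound w d q Q B) {x₀ : ℝ} (hw : w x₀ = 0)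
    (hd : d x₀ = 0) (x : ℝ) : w x = 0 := by
  have hB := h.pos
  set δ : ℝ := 1 / (2 * (B + 2)) with hδ
  have hδ0 : 0 < δ := by positivity
  have hδB : (B + 2) * δ = 1 / 2 := by rw [hδ]; field_simp
  have hδ1 : δ ≤ 1 / 2 := by nlinarith
  have local_zero : ∀ y, w y = 0 ∧ d y = 0 → ∀ z ∈ Set.Icc (y - δ) (y + δ), w z = 0 ∧ d z = 0 := by
    rintro y ⟨hwy, hdy⟩ z hz
    have hy : y ∈ Set.Icc (y - δ) (y + δ) := ⟨by linarith, by linarith⟩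
    obtain ⟨x₁, hx₁, hmax⟩ := h.exists_max (show y - δ ≤ y + δ by linarith)
    have hdm : ∀ x ∈ Set.Icc (y - δ) (y + δ), |d x| ≤ B * |w x₁| := fun x hx => by
      have := h.abs_sub_le (by linarith) hmax hx hy
      rwa [hdy, sub_zero] at this
    have h1 := h.abs_sub_le_mul hdm hx₁ hy
    have h2 : |x₁ - y| ≤ δ := by
      rw [abs_le]
      constructor <;> linarith [hx₁.1, hx₁.2]
    rw [hwy, sub_zero] at h1
    have h3 := mul_le_mul_of_nonneg_left h2 (by positivity : 0 ≤ B * |w x₁|)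
    have h4 : |w x₁| ≤ 0 := by nlinarith [abs_nonneg (w x₁)]
    have h5 := hmax z hz
    have h6 := hdm z hz
    constructor
    · exact abs_nonpos_iff.1 (h5.trans h4)
    · refine abs_nonpos_iff.1 (h6.trans ?_)
      nlinarith
  let Z : Set ℝ := {y | w y = 0 ∧ d y = 0}
  have hZc : IsClosed Z := (isClosed_eq h.isPrimitive.continuous continuous_const).inter
    (isClosed_eq h.isPrimitive_deriv.continuous continuous_const)
  have hZo : IsOpen Z := isOpen_iff_mem_nhds.2 fun y hy =>
    mem_of_superset (Icc_mem_nhds (by linarith) (by linarith)) (local_zero y hy)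
  have hZ : Z = Set.univ := IsClopen.eq_univ ⟨hZc, hZo⟩ ⟨x₀, hw, hd⟩
  have : x ∈ Z := hZ ▸ Set.mem_univ x
  exact this.1

end SecondOrderBound

end GapSoliton

/-! ### The resolvent estimate, cut-offs, and geometric decay. -/

namespace GapSoliton

theorem norm_toLp_sq {f : ℝ → ℝ} (hf : MemLp f 2) : ‖hf.toLp f‖ ^ 2 = ∫ x, f x ^ 2 := by
  rw [← real_inner_self_eq_norm_sq, L2.inner_def]
  refine integral_congr_ae ?_
  filter_upwards [hf.coeFn_toLp] with x hx
  rw [hx, real_inner_self_eq_norm_sq, Real.norm_eq_abs, sq_abs]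

theorem IsPrimitive.hasH1Deriv_toLp {y e : ℝ → ℝ} (h : IsPrimitive y e) (hy : MemLp y 2)
    (he : MemLp e 2) : HasH1Deriv (hy.toLp y) e := by
  refine ⟨Lp.memLp _, he, fun φ hφ => ?_⟩
  rw [← h.integral_mul_deriv_isTest hφ]
  refine integral_congr_ae ?_
  filter_upwards [hy.coeFn_toLp] with x hx
  rw [hx]

/-- Integrate `(e v)' = e v' + (V y - g) v` over the line. The boundary terms vanish because `e` is
bounded and the `H¹` function `v` tends to zero. -/
theorem schrodingerGraph_toLp {V y e p g : ℝ → ℝ} (hV : StepanovBounded V)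
    (hye : IsPrimitive y e) (hep : IsPrimitive e p) (hp : ∀ᵐ x, p x = V x * y x - g x)
    (hy : MemLp y 2) (he : MemLp e 2) (hg : MemLp g 2) {m : ℝ} (hm : ∀ x, |e x| ≤ m) :
    SchrodingerGraph V (hy.toLp y) (hg.toLp g) := by
  refine ⟨e, hye.hasH1Deriv_toLp hy he, fun v' dv hv' => ?_⟩
  obtain ⟨v, hv, hvv'⟩ := hv'.exists_isPrimitive
  have hvL : MemLp v 2 := hv'.memLp.ae_eq hvv'.symm
  have h1 : Integrable (fun x => e x * dv x + V x * y x * v x) :=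
    (he.integrable_mul hv'.memLp_deriv).add
      (hV.integrable_mul_mul hye hy he hv hvL hv'.memLp_deriv)
  have h2 : Integrable (fun x => g x * v x) := hg.integrable_mul hvL
  have h3 := (hep.mul hv).congr_ae (e := fun x => e x * dv x + V x * y x * v x - g x * v x) (by
    filter_upwards [hp] with x hx
    rw [hx]
    ring)
  have hz : ∀ l : Filter ℝ, Tendsto v l (𝓝 0) → Tendsto (fun x => e x * v x) l (𝓝 0) :=
    fun l hl => by
      have : Tendsto (fun x => m * |v x|) l (𝓝 (m * 0)) :=
        ((tendsto_zero_iff_abs_tendsto_zero _).1 hl).const_mul m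
      rw [mul_zero] at this
      refine squeeze_zero_norm (fun x => ?_) this
      rw [Real.norm_eq_abs, abs_mul]
      exact mul_le_mul_of_nonneg_right (hm x) (abs_nonneg _)
  obtain ⟨htop, hbot⟩ := hv.tendsto_zero hvL hv'.memLp_deriv
  have h4 := h3.integral_eq_zero (h1.sub h2) (hz _ htop) (hz _ hbot)
  rw [integral_sub h1 h2, sub_eq_zero] at h4
  refine Eq.trans (integral_congr_ae ?_) (h4.trans (integral_congr_ae ?_))
  · filter_upwards [hy.coeFn_toLp, hvv'] with x hx hx'
    rw [hx, hx']
  · filter_upwards [hg.coeFn_toLp, hvv'] with x hx hx'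
    rw [hx, hx']

/-- The a priori estimate `‖y‖ ≤ ‖L⁻¹‖ ‖L y‖` when `0` is not in the spectrum of `L`. -/
theorem exists_integral_sq_le {V : ℝ → ℝ} (hV : StepanovBounded V)
    (h0 : (0 : ℝ) ∉ schrodingerSpectrum V) : ∃ K : ℝ, 0 < K ∧
    ∀ {y e p g : ℝ → ℝ}, IsPrimitive y e → IsPrimitive e p →
      (∀ᵐ x, p x = V x * y x - g x) → MemLp y 2 → MemLp e 2 → MemLp g 2 →
      (∃ m : ℝ, ∀ x, |e x| ≤ m) → ∫ x, y x ^ 2 ≤ K * ∫ x, g x ^ 2 := by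
  rw [schrodingerSpectrum, Set.mem_ofPred_eq, not_not] at h0
  obtain ⟨A, -, hA⟩ := h0
  refine ⟨‖A‖ ^ 2 + 1, by positivity, ?_⟩
  intro y e p g hye hep hp hy he hg ⟨m, hm⟩
  -- At `s = 0` the left inverse property says `A g = y`, so the operator norm of `A` bounds `y` by
  -- `g`.
  have h1 := hA _ _ (schrodingerGraph_toLp hV hye hep hp hy he hg hm)
  rw [zero_smul, sub_zero] at h1
  rw [← norm_toLp_sq hy, ← norm_toLp_sq hg, ← h1]
  have h2 := A.le_opNorm (hg.toLp g)
  have h3 := pow_le_pow_left₀ (norm_nonneg _) h2 2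
  rw [mul_pow] at h3
  nlinarith [sq_nonneg ‖hg.toLp g‖]

/-- The two components `[-T - 1, -T]` and `[T, T + 1]` of a shell. -/
def shell (T : ℝ) : Set ℝ := Set.Icc (-T - 1) (-T) ∪ Set.Icc T (T + 1)

/-- A smooth cut-off that vanishes on `[-T, T]` and equals `1` off `[-T - 1, T + 1]`; `D` bounds the
function and its first two derivatives. -/
structure IsCutoff (D T : ℝ) (η η' η'' : ℝ → ℝ) : Prop where
  hasDerivAt : ∀ x, HasDerivAt η (η' x) x
  hasDerivAt' : ∀ x, HasDerivAt η' (η'' x) x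
  continuous'' : Continuous η''
  abs_le : ∀ x, |η x| ≤ D
  abs_le' : ∀ x, |η' x| ≤ D
  abs_le'' : ∀ x, |η'' x| ≤ D
  eq_one : ∀ x, T + 1 ≤ |x| → η x = 1
  eq_zero : ∀ x, |x| ≤ T → η x = 0
  deriv_eq_zero : ∀ x, x ∉ shell T → η' x = 0 ∧ η'' x = 0

/-- All cut-offs are built from translates and reflections of one smooth transition, so `D` does not
depend on `T`; this keeps the decay ratio uniform. -/
theorem exists_isCutoff : ∃ D : ℝ, 0 < D ∧ ∀ T : ℝ, 0 ≤ T →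
    ∃ η η' η'' : ℝ → ℝ, IsCutoff D T η η' η'' := by
  set S := Real.smoothTransition with hSdef
  have hS : ContDiff ℝ 2 S := Real.smoothTransition.contDiff (n := 2)
  have hS1 : ContDiff ℝ 1 (deriv S) := (contDiff_succ_iff_deriv (n := 1).1 hS).2.2
  have hd : ∀ x, HasDerivAt S (deriv S x) x := fun x =>
    (hS.differentiable (by norm_num) x).hasDerivAt
  have hd1 : ∀ x, HasDerivAt (deriv S) (deriv (deriv S) x) x := fun x =>
    (hS1.differentiable (by norm_num) x).hasDerivAt
  have hc2 : Continuous (deriv (deriv S)) := hS1.continuous_deriv le_rfl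
  have hsupp : tsupport (deriv S) ⊆ Set.Icc 0 1 := by
    refine closure_minimal (fun x hx => ?_) isClosed_Icc
    by_contra hx'
    apply hx
    rcases lt_or_ge x 0 with h | h
    · have : S =ᶠ[𝓝 x] fun _ => 0 := by
        filter_upwards [Iio_mem_nhds h] with y hy
        exact Real.smoothTransition.zero_of_nonpos (le_of_lt hy)
      rw [this.deriv_eq, deriv_const]
    · have h1 : 1 < x := by
        by_contra! h1
        exact hx' ⟨h, h1⟩
      have : S =ᶠ[𝓝 x] fun _ => 1 := by
        filter_upwards [Ioi_mem_nhds h1] with y hy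
        exact Real.smoothTransition.one_of_one_le (le_of_lt hy)
      rw [this.deriv_eq, deriv_const]
  have hcs : HasCompactSupport (deriv S) := isCompact_Icc.of_isClosed_subset
    (isClosed_tsupport _) hsupp
  have hz1 : ∀ x, x ∉ Set.Icc (0 : ℝ) 1 → deriv S x = 0 := fun x hx =>
    image_eq_zero_of_notMem_tsupport (mt (@hsupp x) hx)
  have hz2 : ∀ x, x ∉ Set.Icc (0 : ℝ) 1 → deriv (deriv S) x = 0 := fun x hx => by
    by_contra hne
    exact hx (hsupp (support_deriv_subset hne))
  obtain ⟨D1, hD1⟩ := hcs.exists_bound_of_continuous hS1.continuous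
  obtain ⟨D2, hD2⟩ := hcs.deriv.exists_bound_of_continuous hc2
  have hD1' : 0 ≤ D1 := (norm_nonneg _).trans (hD1 0)
  have hD2' : 0 ≤ D2 := (norm_nonneg _).trans (hD2 0)
  refine ⟨2 * (1 + D1 + D2), by positivity, fun T hT =>
    ⟨fun x => S (x - T) + S (-x - T), fun x => deriv S (x - T) - deriv S (-x - T),
      fun x => deriv (deriv S) (x - T) + deriv (deriv S) (-x - T), ?_⟩⟩
  have hdr : ∀ x, HasDerivAt (fun x : ℝ => x - T) 1 x := fun x => (hasDerivAt_id x).sub_const T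
  have hdl : ∀ x, HasDerivAt (fun x : ℝ => -x - T) (-1) x := fun x =>
    (hasDerivAt_id x).neg.sub_const T
  constructor
  · intro x
    have := ((hd _).comp x (hdr x)).add ((hd _).comp x (hdl x))
    exact this.congr_deriv (by ring)
  · intro x
    have := ((hd1 _).comp x (hdr x)).sub ((hd1 _).comp x (hdl x))
    exact this.congr_deriv (by ring)
  · fun_prop
  · intro x
    have h1 := Real.smoothTransition.nonneg (x - T)
    have h2 := Real.smoothTransition.nonneg (-x - T)
    have h3 := Real.smoothTransition.le_one (x - T)
    have h4 := Real.smoothTransition.le_one (-x - T)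
    rw [abs_le]
    constructor <;> linarith
  · intro x
    have h1 := hD1 (x - T)
    have h2 := hD1 (-x - T)
    have h3 := abs_sub (deriv S (x - T)) (deriv S (-x - T))
    rw [Real.norm_eq_abs] at h1 h2
    linarith
  · intro x
    have h1 := hD2 (x - T)
    have h2 := hD2 (-x - T)
    have h3 := abs_add_le (deriv (deriv S) (x - T)) (deriv (deriv S) (-x - T))
    rw [Real.norm_eq_abs] at h1 h2
    linarith
  · intro x hx
    rcases le_abs.1 hx with h | h
    · simp only [hSdef]
      rw [Real.smoothTransition.one_of_one_le (by linarith),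
        Real.smoothTransition.zero_of_nonpos (by linarith), add_zero]
    · simp only [hSdef]
      rw [Real.smoothTransition.zero_of_nonpos (by linarith),
        Real.smoothTransition.one_of_one_le (by linarith), zero_add]
  · intro x hx
    have := abs_le.1 hx
    simp only [hSdef]
    rw [Real.smoothTransition.zero_of_nonpos (by linarith),
      Real.smoothTransition.zero_of_nonpos (by linarith), add_zero]
  · intro x hx
    simp only [shell, Set.mem_union, Set.mem_Icc, not_or] at hx
    have h1 : x - T ∉ Set.Icc (0 : ℝ) 1 := fun h => hx.2 ⟨by linarith [h.1], by linarith [h.2]⟩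
    have h2 : -x - T ∉ Set.Icc (0 : ℝ) 1 := fun h => hx.1 ⟨by linarith [h.2], by linarith [h.1]⟩
    simp [hz1 _ h1, hz1 _ h2, hz2 _ h1, hz2 _ h2]

theorem exists_exp_bound_of_geometric {P : ℝ → ℝ} {M : ℕ → ℝ} {C ρ : ℝ} {N : ℕ} (hC : 0 ≤ C)
    (hρ : 0 < ρ) (hρ1 : ρ < 1) (hM : Antitone M) (hM0 : ∀ n, 0 ≤ M n)
    (hstep : ∀ n, N ≤ n → M (n + 1) ≤ ρ * M n)
    (hP : ∀ (n : ℕ) (x : ℝ), n ≤ |x| → |x| ≤ n + 1 → P x ≤ C * M n) :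
    ∃ α β : ℝ, 0 < α ∧ 0 < β ∧ ∀ x, P x ≤ α * Real.exp (-β * |x|) := by
  have h1 : ∀ n, M n * ρ ^ N ≤ M 0 * ρ ^ n := by
    intro n
    rcases le_total n N with h | h
    · exact mul_le_mul (hM (Nat.zero_le n)) (pow_le_pow_of_le_one hρ.le hρ1.le h)
        (by positivity) (hM0 0)
    · induction n, h using Nat.le_induction with
      | base => exact mul_le_mul_of_nonneg_right (hM (Nat.zero_le N)) (by positivity)
      | succ n hn ih =>
        calc M (n + 1) * ρ ^ N ≤ ρ * M n * ρ ^ N :=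
              mul_le_mul_of_nonneg_right (hstep n hn) (by positivity)
          _ = ρ * (M n * ρ ^ N) := by ring
          _ ≤ ρ * (M 0 * ρ ^ n) := mul_le_mul_of_nonneg_left ih hρ.le
          _ = M 0 * ρ ^ (n + 1) := by ring
  have hlog : Real.log ρ < 0 := Real.log_neg hρ hρ1
  have hM00 := hM0 0
  -- Dividing by `ρ ^ N` pays for the first `N` steps, where `M` is only monotone; the factor `1 /
  -- ρ` pays for rounding `|x|` down; the `+ 1` keeps the constant positive if `C * M 0 = 0`.
  refine ⟨C * (M 0 / ρ ^ N) * Real.exp (-Real.log ρ) + 1, -Real.log ρ, by positivity,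
    by linarith, fun x => ?_⟩
  set n := ⌊|x|⌋₊
  have hn1 : (n : ℝ) ≤ |x| := Nat.floor_le (abs_nonneg x)
  have hn2 : |x| ≤ n + 1 := (Nat.lt_floor_add_one _).le
  have h2 : M n ≤ M 0 / ρ ^ N * ρ ^ n := by
    rw [div_mul_eq_mul_div, le_div_iff₀ (by positivity)]
    exact h1 n
  have h3 : ρ ^ n ≤ Real.exp (-Real.log ρ) * Real.exp (- -Real.log ρ * |x|) := by
    rw [← Real.exp_add, ← Real.exp_log (pow_pos hρ n), Real.log_pow, Real.exp_le_exp]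
    nlinarith
  calc P x ≤ C * M n := hP n x hn1 hn2
    _ ≤ C * (M 0 / ρ ^ N * (Real.exp (-Real.log ρ) * Real.exp (- -Real.log ρ * |x|))) := by
        gcongr
        exact h2.trans (by gcongr)
    _ = C * (M 0 / ρ ^ N) * Real.exp (-Real.log ρ) * Real.exp (- -Real.log ρ * |x|) := by ring
    _ ≤ _ := by
        gcongr
        linarith

end GapSoliton

/-! ### Tail mass and exponential decay. -/

namespace GapSoliton

theorem MemLp.mul_of_abs_le {η w : ℝ → ℝ} {D : ℝ} (hw : MemLp w 2) (hη : Continuous η)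
    (hD : ∀ x, |η x| ≤ D) : MemLp (fun x => η x * w x) 2 := by
  refine hw.of_le_mul (c := D) (hη.aestronglyMeasurable.mul hw.aestronglyMeasurable)
    (Eventually.of_forall fun x => ?_)
  rw [Real.norm_eq_abs, Real.norm_eq_abs, abs_mul]
  exact mul_le_mul_of_nonneg_right (hD x) (abs_nonneg _)

theorem measurableSet_shell (T : ℝ) : MeasurableSet (shell T) :=
  measurableSet_Icc.union measurableSet_Icc

theorem volume_shell_le (T : ℝ) : volume (shell T) ≤ 2 := by
  refine (measure_union_le _ _).trans ?_
  rw [Real.volume_Icc, Real.volume_Icc, show -T - (-T - 1) = 1 by ring,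
    show T + 1 - T = 1 by ring, ENNReal.ofReal_one, one_add_one_eq_two]

theorem integral_le_of_shell {φ : ℝ → ℝ} {T c : ℝ} (hφ : Integrable φ) (hc : 0 ≤ c)
    (h0 : ∀ x, x ∉ shell T → φ x = 0) (h1 : ∀ x ∈ shell T, φ x ≤ c) : ∫ x, φ x ≤ 2 * c := by
  have hv : volume (shell T) ≠ ∞ := ((volume_shell_le T).trans_lt (by simp)).ne
  have h2 : ∫ x, φ x ≤ ∫ x, (shell T).indicator (fun _ => c) x := by
    refine integral_mono hφ ((integrable_indicator_iff (measurableSet_shell T)).2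
      (integrableOn_const hv)) fun x => ?_
    by_cases hx : x ∈ shell T
    · rw [Set.indicator_of_mem hx]
      exact h1 x hx
    · rw [Set.indicator_of_notMem hx, h0 x hx]
  refine h2.trans ?_
  rw [integral_indicator_const c (measurableSet_shell T), smul_eq_mul]
  refine mul_le_mul_of_nonneg_right ?_ hc
  exact ENNReal.toReal_mono (by simp) (volume_shell_le T)

/-- Places a shell point in a unit interval, as the local elliptic estimate needs, with mass at most
the loss of tail mass from `T` to `T + 1`. -/
theorem integral_shell_le {φ : ℝ → ℝ} (hφ : Integrable φ) (h0 : ∀ x, 0 ≤ φ x) {T x : ℝ}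
    (hx : x ∈ shell T) : ∃ t, x ∈ Set.Icc t (t + 1) ∧
      ∫ y in t..t + 1, φ y ≤ (∫ y in -(T + 1)..T + 1, φ y) - ∫ y in -T..T, φ y := by
  have hi : ∀ a b, IntervalIntegrable φ volume a b := fun a b => hφ.intervalIntegrable
  have h1 := intervalIntegral.integral_add_adjacent_intervals (hi (-(T + 1)) (-T)) (hi (-T) T)
  have h2 := intervalIntegral.integral_add_adjacent_intervals (hi (-(T + 1)) T) (hi T (T + 1))
  have h3 : 0 ≤ ∫ y in -(T + 1)..-T, φ y :=
    intervalIntegral.integral_nonneg (by linarith) fun y _ => h0 y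
  have h4 : 0 ≤ ∫ y in T..T + 1, φ y :=
    intervalIntegral.integral_nonneg (by linarith) fun y _ => h0 y
  rcases hx with hx | hx
  · refine ⟨-(T + 1), ⟨by linarith [hx.1], by linarith [hx.2]⟩, ?_⟩
    rw [show -(T + 1) + 1 = -T by ring]
    linarith
  · exact ⟨T, hx, by linarith⟩

/-- The mass of `w²` outside `[-T, T]`. -/
noncomputable def tailMass (w : ℝ → ℝ) (T : ℝ) : ℝ := (∫ x, w x ^ 2) - ∫ x in -T..T, w x ^ 2

theorem tailMass_eq {w : ℝ → ℝ} (hw : MemLp w 2) {T : ℝ} (hT : 0 ≤ T) :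
    tailMass w T = ∫ x in (Set.Ioc (-T) T)ᶜ, w x ^ 2 := by
  rw [tailMass, intervalIntegral.integral_of_le (by linarith),
    ← integral_add_compl measurableSet_Ioc hw.integrable_sq]
  ring

theorem tailMass_nonneg {w : ℝ → ℝ} (hw : MemLp w 2) {T : ℝ} (hT : 0 ≤ T) : 0 ≤ tailMass w T := by
  rw [tailMass_eq hw hT]
  exact integral_nonneg fun x => sq_nonneg _

theorem tailMass_anti {w : ℝ → ℝ} (hw : MemLp w 2) {T T' : ℝ} (hT : 0 ≤ T) (h : T ≤ T') :
    tailMass w T' ≤ tailMass w T := by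
  have := intervalIntegral_le_of_subset (h := fun x => w x ^ 2) (show -T ≤ T by linarith)
    (show -T' ≤ -T by linarith) h (fun _ => sq_nonneg _) hw.integrable_sq.intervalIntegrable
  rw [tailMass, tailMass]
  linarith

theorem tailMass_le_of_eq_one {η w : ℝ → ℝ} (hw : MemLp w 2) {T : ℝ} (hT : 0 ≤ T)
    (hη : ∀ x, T ≤ |x| → η x = 1) (hi : Integrable fun x => (η x * w x) ^ 2) :
    tailMass w T ≤ ∫ x, (η x * w x) ^ 2 := by
  rw [tailMass_eq hw hT]
  have : ∫ x in (Set.Ioc (-T) T)ᶜ, w x ^ 2 = ∫ x in (Set.Ioc (-T) T)ᶜ, (η x * w x) ^ 2 := by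
    refine setIntegral_congr_fun measurableSet_Ioc.compl fun x hx => ?_
    have : T ≤ |x| := by
      by_contra! hlt
      rw [abs_lt] at hlt
      exact hx ⟨hlt.1, hlt.2.le⟩
    simp [hη x this]
  rw [this]
  exact setIntegral_le_integral hi (Eventually.of_forall fun x => sq_nonneg _)

/-- Exponential decay of an `H¹` solution of `-w'' + V w = r` with `r = O(w²)`, when `0` is not in
the spectrum of `-d²/dx² + V`. -/
theorem SecondOrderBound.exists_exp_bound {V w d q Q r : ℝ → ℝ} {B C₀ : ℝ}
    (hV : StepanovBounded V) (hV0 : (0 : ℝ) ∉ schrodingerSpectrum V)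
    (h : SecondOrderBound w d q Q B) (hw : MemLp w 2) (hd : MemLp d 2)
    (hq : ∀ᵐ x, q x = V x * w x - r x) (hr : AEStronglyMeasurable r volume) (hC₀ : 0 < C₀)
    (hrw : ∀ᵐ x, |r x| ≤ C₀ * w x ^ 2) :
    ∃ α β : ℝ, 0 < α ∧ 0 < β ∧ ∀ x, w x ^ 2 + d x ^ 2 ≤ α * Real.exp (-β * |x|) := by
  obtain ⟨K, hK, hres⟩ := exists_integral_sq_le hV hV0
  obtain ⟨D, hD, hcut⟩ := exists_isCutoff
  obtain ⟨C, hC, hloc⟩ := h.exists_sq_add_sq_le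
  obtain ⟨R, hR, hwR⟩ := h.isPrimitive.exists_abs_le hw hd
  have hw2 := hw.integrable_sq
  have hdR : ∃ R', ∀ x, |d x| ≤ R' := by
    refine ⟨C * (∫ y, w y ^ 2) + 1, fun x => abs_le_of_sq_le_sq ?_ ?_⟩
    · have h1 := hloc x x ⟨le_rfl, by linarith⟩
      have h2 : ∫ y in x..x + 1, w y ^ 2 ≤ ∫ y, w y ^ 2 := by
        rw [intervalIntegral.integral_of_le (by linarith)]
        exact setIntegral_le_integral hw2 (Eventually.of_forall fun y => sq_nonneg _)
      have h3 : 0 ≤ ∫ y, w y ^ 2 := integral_nonneg fun y => sq_nonneg _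
      have h4 := mul_le_mul_of_nonneg_left h2 hC.le
      nlinarith [sq_nonneg (w x), mul_nonneg hC.le h3]
    · have h3 : 0 ≤ ∫ y, w y ^ 2 := integral_nonneg fun y => sq_nonneg _
      positivity
  obtain ⟨R', hdR⟩ := hdR
  have hrL : MemLp r 2 := by
    refine hw.of_le_mul (c := C₀ * R) hr ?_
    filter_upwards [hrw] with x hx
    rw [Real.norm_eq_abs, Real.norm_eq_abs]
    refine hx.trans ?_
    rw [← sq_abs, sq, ← mul_assoc]
    gcongr
    exact hwR x
  -- Makes `C₀ ^ 2 * ε = 1 / (4 K)`: after the factor `2` from squaring a difference and the factor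
  -- `K`, the nonlinear term costs half of the left side.
  set ε : ℝ := 1 / (4 * K * C₀ ^ 2) with hε
  have hε0 : 0 < ε := by positivity
  -- far out, `r` is a small multiple of `w`
  obtain ⟨N, hN⟩ : ∃ N : ℕ, ∀ x, (N : ℝ) ≤ |x| → w x ^ 2 ≤ ε := by
    obtain ⟨htop, hbot⟩ := h.isPrimitive.tendsto_zero hw hd
    have ht : Tendsto w (cocompact ℝ) (𝓝 0) := by
      rw [cocompact_eq_atBot_atTop]
      exact tendsto_sup.2 ⟨hbot, htop⟩
    have ht2 := ht.pow 2
    rw [zero_pow two_ne_zero] at ht2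
    have hev := ht2.eventually (eventually_le_nhds hε0)
    rw [← Metric.cobounded_eq_cocompact, ← comap_norm_atTop, eventually_comap] at hev
    obtain ⟨a, ha⟩ := eventually_atTop.1 hev
    obtain ⟨N, hN⟩ := exists_nat_ge a
    exact ⟨N, fun x hx => ha |x| (hN.trans hx) x rfl⟩
  -- `10 D² C` bounds `ψ²` per unit of shell mass, the inner `2` is the measure of the shell, and
  -- `4` is `2` from squaring a difference times `2` from absorption.
  set C₁ : ℝ := 4 * K * (2 * (10 * D ^ 2 * C)) with hC₁
  have hC₁0 : 0 < C₁ := by positivity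
  have step : ∀ T : ℝ, 0 ≤ T → (N : ℝ) ≤ T →
      tailMass w (T + 1) ≤ C₁ * (tailMass w T - tailMass w (T + 1)) := by
    intro T hT hNT
    obtain ⟨η, η', η'', hη⟩ := hcut T hT
    have hηc : Continuous η := continuous_iff_continuousAt.2 fun x => (hη.hasDerivAt x).continuousAt
    have hηc' : Continuous η' :=
      continuous_iff_continuousAt.2 fun x => (hη.hasDerivAt' x).continuousAt
    have hP := (IsPrimitive.of_hasDerivAt hη.hasDerivAt hηc').mul h.isPrimitive
    have hP' := ((IsPrimitive.of_hasDerivAt hη.hasDerivAt' hη.continuous'').mul h.isPrimitive).add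
      ((IsPrimitive.of_hasDerivAt hη.hasDerivAt hηc').mul h.isPrimitive_deriv)
    -- The commutator term: `(η w)'' = η w'' + ψ`, so `L (η w) = η r - ψ`, with `ψ` supported in the
    -- shell.
    set ψ : ℝ → ℝ := fun x => 2 * (η' x * d x) + η'' x * w x with hψ
    have hηw := MemLp.mul_of_abs_le hw hηc hη.abs_le
    have hηr := MemLp.mul_of_abs_le hrL hηc hη.abs_le
    have hψL : MemLp ψ 2 := ((MemLp.mul_of_abs_le hd hηc' hη.abs_le').const_mul 2).add
      (MemLp.mul_of_abs_le hw hη.continuous'' hη.abs_le'')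
    have hg : MemLp (fun x => η x * r x - ψ x) 2 := hηr.sub hψL
    have he : MemLp (fun x => η' x * w x + η x * d x) 2 :=
      (MemLp.mul_of_abs_le hw hηc' hη.abs_le').add (MemLp.mul_of_abs_le hd hηc hη.abs_le)
    have hbd : ∀ x, |η' x * w x + η x * d x| ≤ D * R + D * R' := fun x => by
      refine (abs_add_le _ _).trans ?_
      rw [abs_mul, abs_mul]
      exact add_le_add
        (mul_le_mul (hη.abs_le' x) (hwR x) (abs_nonneg _) hD.le)
        (mul_le_mul (hη.abs_le x) (hdR x) (abs_nonneg _) hD.le)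
    have h1 := hres hP hP' (g := fun x => η x * r x - ψ x) (by
      filter_upwards [hq] with x hx
      rw [hx, hψ]
      ring) hηw he hg ⟨_, hbd⟩
    set I := ∫ x, (η x * w x) ^ 2 with hI
    set a := (∫ y in -(T + 1)..T + 1, w y ^ 2) - ∫ y in -T..T, w y ^ 2 with ha
    have ha' : a = tailMass w T - tailMass w (T + 1) := by rw [ha, tailMass, tailMass]; ring
    have ha0 : 0 ≤ a := by
      rw [ha', sub_nonneg]
      exact tailMass_anti hw hT (by linarith)
    have h2 : ∫ x, (η x * r x - ψ x) ^ 2 ≤ 1 / (2 * K) * I + 2 * ∫ x, ψ x ^ 2 := by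
      rw [hI, ← integral_const_mul, ← integral_const_mul,
        ← integral_add (hηw.integrable_sq.const_mul _) (hψL.integrable_sq.const_mul _)]
      refine integral_mono_ae hg.integrable_sq
        ((hηw.integrable_sq.const_mul _).add (hψL.integrable_sq.const_mul _)) ?_
      filter_upwards [hrw] with x hx
      have h3 : (η x * r x) ^ 2 ≤ 1 / (4 * K) * (η x * w x) ^ 2 := by
        rcases le_total |x| T with hxT | hxT
        · rw [hη.eq_zero x hxT]
          simp
        · have h4 : r x ^ 2 ≤ (C₀ * w x ^ 2) ^ 2 := by
            rw [← sq_abs (r x)]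
            gcongr
          have h5 : (C₀ * w x ^ 2) ^ 2 ≤ 1 / (4 * K) * w x ^ 2 := by
            calc (C₀ * w x ^ 2) ^ 2 = C₀ ^ 2 * w x ^ 2 * w x ^ 2 := by ring
              _ ≤ C₀ ^ 2 * ε * w x ^ 2 := by
                  gcongr
                  exact hN x (hNT.trans hxT)
              _ = 1 / (4 * K) * w x ^ 2 := by rw [hε]; field_simp
          rw [mul_pow, mul_pow, mul_left_comm]
          exact mul_le_mul_of_nonneg_left (h4.trans h5) (sq_nonneg _)
      have h6 : 1 / (2 * K) * (η x * w x) ^ 2 = 2 * (1 / (4 * K) * (η x * w x) ^ 2) := by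
        field_simp
        ring
      nlinarith [sq_nonneg (η x * r x + ψ x)]
    have h3 : ∫ x, ψ x ^ 2 ≤ 2 * (10 * D ^ 2 * C * a) := by
      refine integral_le_of_shell (T := T) hψL.integrable_sq (by positivity) (fun x hx => ?_)
        fun x hx => ?_
      · simp [hψ, hη.deriv_eq_zero x hx]
      · obtain ⟨t, hxt, hta⟩ := integral_shell_le hw2 (fun y => sq_nonneg (w y)) hx
        have h4 := (hloc t x hxt).trans (mul_le_mul_of_nonneg_left hta hC.le)
        have h5 : η' x ^ 2 ≤ D ^ 2 := by
          rw [← sq_abs]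
          exact pow_le_pow_left₀ (abs_nonneg _) (hη.abs_le' x) 2
        have h6 : η'' x ^ 2 ≤ D ^ 2 := by
          rw [← sq_abs]
          exact pow_le_pow_left₀ (abs_nonneg _) (hη.abs_le'' x) 2
        calc ψ x ^ 2 ≤ 8 * (η' x ^ 2 * d x ^ 2) + 2 * (η'' x ^ 2 * w x ^ 2) := by
              rw [hψ]
              nlinarith [sq_nonneg (2 * (η' x * d x) - η'' x * w x)]
          _ ≤ 8 * (D ^ 2 * d x ^ 2) + 2 * (D ^ 2 * w x ^ 2) := by gcongr
          _ ≤ 10 * D ^ 2 * (w x ^ 2 + d x ^ 2) := by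
              nlinarith [mul_nonneg (sq_nonneg D) (sq_nonneg (w x)),
                mul_nonneg (sq_nonneg D) (sq_nonneg (d x))]
          _ ≤ 10 * D ^ 2 * (C * a) := mul_le_mul_of_nonneg_left h4 (by positivity)
          _ = 10 * D ^ 2 * C * a := by ring
    have h4 := tailMass_le_of_eq_one hw (by linarith) hη.eq_one hηw.integrable_sq
    have h5 : I ≤ K * (1 / (2 * K) * I + 2 * (2 * (10 * D ^ 2 * C * a))) :=
      h1.trans (mul_le_mul_of_nonneg_left (h2.trans (by linarith)) hK.le)
    have h6 : K * (1 / (2 * K) * I + 2 * (2 * (10 * D ^ 2 * C * a))) = I / 2 + C₁ * a / 2 := by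
      rw [hC₁]
      field_simp
      ring
    rw [← ha']
    linarith
  -- Hole filling: adding `C₁` times the outer tail mass to both sides of `step` gives this
  -- contraction ratio.
  have hρ : C₁ / (1 + C₁) < 1 := by
    rw [div_lt_one (by positivity)]
    linarith
  refine exists_exp_bound_of_geometric (P := fun x => w x ^ 2 + d x ^ 2)
    (M := fun n => tailMass w n) (N := N) hC.le (by positivity) hρ
    (fun m n hmn => tailMass_anti hw (Nat.cast_nonneg m) (Nat.cast_le.2 hmn))
    (fun n => tailMass_nonneg hw (Nat.cast_nonneg n)) (fun n hn => ?_) fun n x hx1 hx2 => ?_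
  · have h1 := step n (Nat.cast_nonneg n) (Nat.cast_le.2 hn)
    rw [div_mul_eq_mul_div, le_div_iff₀ (by positivity), Nat.cast_add_one]
    linarith
  · have hx : x ∈ shell n := by
      rcases le_total 0 x with h0 | h0
      · rw [abs_of_nonneg h0] at hx1 hx2
        exact .inr ⟨hx1, hx2⟩
      · rw [abs_of_nonpos h0] at hx1 hx2
        exact .inl ⟨by linarith, by linarith⟩
    obtain ⟨t, hxt, hta⟩ := integral_shell_le hw2 (fun y => sq_nonneg (w y)) hx
    refine (hloc t x hxt).trans (mul_le_mul_of_nonneg_left (hta.trans ?_) hC.le)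
    have h1 := tailMass_nonneg hw (T := (n : ℝ) + 1) (by positivity)
    rw [tailMass] at h1 ⊢
    linarith

end GapSoliton

/-! ### The nonlinearity and regularity of weak solutions. -/

namespace GapSoliton

/-- The superposition of a Carathéodory function with a measurable function is measurable. -/
theorem IsCaratheodory.aemeasurable_comp {f : ℝ → ℝ → ℝ} (hf : IsCaratheodory f) {w : ℝ → ℝ}
    (hw : Measurable w) : AEMeasurable (fun x => f x (w x)) volume := by
  -- Round `w` down to a lattice: on each of countably many level sets the second argument of `f` is
  -- constant, and continuity in `u` passes to the limit.
  let s : ℕ → ℝ → ℝ := fun n x => (⌊((n : ℝ) + 1) * w x⌋ : ℝ) / ((n : ℝ) + 1)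
  have hs : ∀ n, AEMeasurable (fun x => f x (s n x)) volume := fun n => by
    have hm : Measurable fun x => ⌊((n : ℝ) + 1) * w x⌋ := (hw.const_mul _).floor
    have hu : (⋃ k : ℤ, {x | ⌊((n : ℝ) + 1) * w x⌋ = k}) = Set.univ := by
      ext x
      simp
    rw [← Measure.restrict_univ (μ := volume), ← hu, aemeasurable_iUnion_iff]
    intro k
    refine (hf.2 ((k : ℝ) / ((n : ℝ) + 1))).restrict.congr ?_
    filter_upwards [ae_restrict_mem (hm (measurableSet_singleton k))] with x hx
    have hx' : ⌊((n : ℝ) + 1) * w x⌋ = k := hx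
    simp only [s, hx']
  refine aemeasurable_of_tendsto_metrizable_ae atTop hs ?_
  filter_upwards [hf.1] with x hx
  refine (hx.tendsto (w x)).comp ?_
  have h1 : Tendsto (fun n : ℕ => ((n : ℝ) + 1)⁻¹) atTop (𝓝 0) := by
    simpa using tendsto_one_div_add_atTop_nhds_zero_nat (𝕜 := ℝ)
  have h2 : Tendsto (fun n : ℕ => w x - ((n : ℝ) + 1)⁻¹) atTop (𝓝 (w x)) := by
    simpa using h1.const_sub (w x)
  refine tendsto_of_tendsto_of_tendsto_of_le_of_le h2 tendsto_const_nhds (fun n => ?_) fun n => ?_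
  · have hn : (0 : ℝ) < (n : ℝ) + 1 := by positivity
    have h3 := Int.lt_floor_add_one (((n : ℝ) + 1) * w x)
    simp only [s]
    rw [le_div_iff₀ hn, sub_mul, inv_mul_cancel₀ hn.ne']
    linarith
  · have hn : (0 : ℝ) < (n : ℝ) + 1 := by positivity
    have h3 := Int.floor_le (((n : ℝ) + 1) * w x)
    simp only [s]
    rw [div_le_iff₀ hn]
    linarith

/-- Since `f_u(x, 0) = 0`, the Lipschitz bound gives `|f_u(x, z)| ≤ μ |u|` for `|z| ≤ |u|`; the mean
value inequality from `f(x, 0) = 0` adds the second factor `|u|`. -/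
theorem NonlinearityAssumption.exists_abs_le {f : ℝ → ℝ → ℝ} (hf : NonlinearityAssumption f)
    {R : ℝ} (hR : 0 < R) : ∃ μ : ℝ, 0 < μ ∧ ∀ᵐ x, ∀ u, |u| ≤ R → |f x u| ≤ μ * u ^ 2 := by
  obtain ⟨μ, hμ, hlip⟩ := hf.lipschitz R hR
  refine ⟨μ, hμ, ?_⟩
  filter_upwards [hlip, hf.contDiff, hf.at_zero] with x hx hc h0 u hu
  have hd : ∀ z ∈ Set.Icc (-|u|) |u|, ‖deriv (f x) z‖ ≤ μ * |u| := fun z hz => by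
    have hz' : |z| ≤ |u| := abs_le.2 hz
    have h1 := hx z 0 (hz'.trans hu) (by simpa using hR.le)
    rw [h0.2, sub_zero, sub_zero] at h1
    exact h1.trans (mul_le_mul_of_nonneg_left hz' hμ.le)
  have h2 := (convex_Icc (-|u|) |u|).norm_image_sub_le_of_norm_deriv_le
    (fun z _ => hc.differentiable one_ne_zero z) hd
    (x := 0) (y := u) (by simp) (abs_le.1 le_rfl)
  rw [h0.1, sub_zero, sub_zero, Real.norm_eq_abs, Real.norm_eq_abs] at h2
  refine h2.trans (le_of_eq ?_)
  rw [mul_assoc, ← sq, sq_abs]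

/-- Regularity: a weak solution in `H¹` has a `C¹` representative `w`, whose derivative is locally
absolutely continuous with `w'' = V w - χ f(x, w)`. -/
theorem IsWeakSolution.exists_isPrimitive {χ : ℝ} {V : ℝ → ℝ} {f : ℝ → ℝ → ℝ} {u du : ℝ → ℝ}
    (hu : IsWeakSolution χ V f u du) (hV : StepanovBounded V) (hf : NonlinearityAssumption f) :
    ∃ w d : ℝ → ℝ, w =ᵐ[volume] u ∧ d =ᵐ[volume] du ∧ IsPrimitive w d ∧
      IsPrimitive d (fun x => V x * w x - χ * f x (w x)) ∧
      MemLp w 2 ∧ MemLp d 2 ∧ AEMeasurable (fun x => f x (w x)) volume ∧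
      ∃ μ : ℝ, 0 < μ ∧ ∀ᵐ x, |f x (w x)| ≤ μ * w x ^ 2 := by
  obtain ⟨w, hw, hwu⟩ := hu.1.exists_isPrimitive
  have hwL : MemLp w 2 := hu.1.memLp.ae_eq hwu.symm
  obtain ⟨R, hR, hwR⟩ := hw.exists_abs_le hwL hu.1.memLp_deriv
  obtain ⟨μ, hμ, hfμ⟩ := hf.exists_abs_le hR
  have hm := hf.ap.1.aemeasurable_comp hw.continuous.measurable
  have hfw : ∀ᵐ x, |f x (w x)| ≤ μ * w x ^ 2 := by
    filter_upwards [hfμ] with x hx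
    exact hx _ (hwR x)
  have hfi : LocallyIntegrable (fun x => f x (w x)) volume := by
    refine Integrable.locallyIntegrable ((hwL.integrable_sq.const_mul μ).mono'
      hm.aestronglyMeasurable ?_)
    exact hfw
  have hVw : LocallyIntegrable (fun x => V x * w x) volume :=
    locallyIntegrable_of_intervalIntegrable fun a b =>
      (hV.locallyIntegrable.intervalIntegrable_real a b).mul_continuousOn hw.continuous.continuousOn
  have hχf : LocallyIntegrable (fun x => χ * f x (w x)) volume := hfi.smul χ
  have hdu : LocallyIntegrable du volume := hu.1.memLp_deriv.locallyIntegrable (by norm_num)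
  -- The weak equation says exactly that `du` has the locally integrable weak derivative `V w - χ
  -- f(x, w)`.
  obtain ⟨d, hd, hdu'⟩ := exists_isPrimitive_of_weak hdu (hVw.sub hχf) fun φ hφ => by
    have h1 := hu.2 φ hφ
    have h2 : ∫ x, (du x * deriv φ x + V x * u x * φ x) =
        ∫ x, (du x * deriv φ x + V x * w x * φ x) := by
      refine integral_congr_ae ?_
      filter_upwards [hwu] with x hx
      rw [hx]
    have h3 : ∫ x, f x (u x) * φ x = ∫ x, f x (w x) * φ x := by
      refine integral_congr_ae ?_
      filter_upwards [hwu] with x hx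
      rw [hx]
    rw [h2, h3, integral_add (hφ.deriv.integrable_mul hdu) (hφ.integrable_mul hVw)] at h1
    simp_rw [Pi.sub_apply, sub_mul]
    rw [integral_sub (hφ.integrable_mul hVw) (hφ.integrable_mul hχf)]
    simp_rw [mul_assoc χ]
    rw [integral_const_mul]
    linarith
  exact ⟨w, d, hwu, hdu', hw.congr_ae hdu'.symm, hd, hwL, hu.1.memLp_deriv.ae_eq hdu'.symm, hm,
    μ, hμ, hfw⟩

end GapSoliton

/-! ### Conclusion: positivity and decay of the solution. -/

theorem proposition6p1 (χ : ℝ) (hχ : χ = 1 ∨ χ = -1) (V : ℝ → ℝ) (f : ℝ → ℝ → ℝ)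
    (hV : GapSoliton.PotentialAssumption χ V) (hf : GapSoliton.NonlinearityAssumption f)
    (u du : ℝ → ℝ) (hu : GapSoliton.IsWeakSolution χ V f u du)
    (hne : ¬ u =ᵐ[volume] (fun _ => (0 : ℝ))) :
    ∃ w : ℝ → ℝ, w =ᵐ[volume] u ∧ deriv w =ᵐ[volume] du ∧
      Differentiable ℝ w ∧ Continuous (deriv w) ∧
      ∃ α β : ℝ, 0 < α ∧ 0 < β ∧ ∀ x : ℝ,
        0 < |w x| + |deriv w x| ∧ |w x| + |deriv w x| ≤ α * Real.exp (-β * |x|) := by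
  have hVb := hV.almostPeriodic.1
  obtain ⟨w, d, hwu, hdu, hw, hd, hwL, hdL, hm, μ, hμ, hfw⟩ := hu.exists_isPrimitive hVb hf
  have hderiv : ∀ x, HasDerivAt w (d x) x := hw.hasDerivAt hd.continuous
  have hde : deriv w = d := funext fun x => (hderiv x).deriv
  have hχ1 : |χ| = 1 := by rcases hχ with rfl | rfl <;> simp
  obtain ⟨R, hR, hwR⟩ := hw.exists_abs_le hwL hdL
  obtain ⟨B, hB, hVB⟩ := hVb.exists_integral_le
  have hVi := hVb.locallyIntegrable.intervalIntegrable_real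
  -- One factor `|w| ≤ R` of the quadratic bound goes into the potential: `μ w² ≤ μ R |w|`.
  have hS : GapSoliton.SecondOrderBound w d (fun x => V x * w x - χ * f x (w x))
      (fun x => |V x| + μ * R) (B + μ * R) := by
    refine ⟨hw, hd, fun a b => (hVi a b).abs.add intervalIntegrable_const,
      fun x => by positivity, by positivity, fun t => ?_, ?_⟩
    · rw [intervalIntegral.integral_add (hVi _ _).abs intervalIntegrable_const,
        intervalIntegral.integral_const, add_sub_cancel_left, one_smul]
      linarith [hVB t]
    · filter_upwards [hfw] with x hx
      have h1 := abs_sub (V x * w x) (χ * f x (w x))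
      rw [abs_mul, abs_mul, hχ1, one_mul] at h1
      have h2 : μ * w x ^ 2 ≤ μ * R * |w x| := by
        rw [← sq_abs, sq, ← mul_assoc]
        gcongr
        exact hwR x
      linarith
  have hχf : ∀ᵐ x, |χ * f x (w x)| ≤ μ * w x ^ 2 := by
    filter_upwards [hfw] with x hx
    rwa [abs_mul, hχ1, one_mul]
  obtain ⟨α, β, hα, hβ, hdec⟩ := hS.exists_exp_bound hVb hV.zero_notMem hwL hdL
    (r := fun x => χ * f x (w x)) (Eventually.of_forall fun x => rfl)
    (hm.const_mul χ).aestronglyMeasurable hμ hχf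
  -- The constants come from taking the root of `(|w| + |d|)² ≤ 2 (w² + d²) ≤ 2 α exp (-β |x|)`.
  refine ⟨w, hwu, hde ▸ hdu, fun x => (hderiv x).differentiableAt, hde ▸ hd.continuous,
    Real.sqrt (2 * α), β / 2, by positivity, by positivity, fun x => ?_⟩
  rw [hde]
  constructor
  · by_contra! h
    have h1 : w x = 0 := abs_nonpos_iff.1 (by linarith [abs_nonneg (d x)])
    have h2 : d x = 0 := abs_nonpos_iff.1 (by linarith [abs_nonneg (w x)])
    refine hne (hwu.symm.trans (Eventually.of_forall fun y => ?_))
    exact hS.eq_zero_of_initial h1 h2 y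
  · refine abs_le_of_sq_le_sq' ?_ (by positivity) |>.2
    rw [mul_pow, Real.sq_sqrt (by positivity), ← Real.exp_nat_mul]
    have h1 : ((2 : ℕ) : ℝ) * (-(β / 2) * |x|) = -β * |x| := by
      push_cast
      ring
    rw [h1]
    nlinarith [hdec x, sq_nonneg (|w x| - |d x|), sq_abs (w x), sq_abs (d x)]
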